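/- Let $V'$ be a finite-dimensional smooth manifold without boundary with a smooth 1-form $\alpha'$ such that $\omega'=d\alpha'$ is nondegenerate, i.e. $(V',\omega')$ is an exact symplectic manifold (for example the symplectization $(U\times(0,\infty),\,d(a\lambda))$ of a contact manifold $(U,\lambda)$). Let $J'$ be a smooth almost complex structure and $g'$ a smooth Riemannian metric on $V'$ with $g'=\omega'(\cdot,J'\cdot)$. On $\mathbb C$ let $\omega_0=dx\wedge dy$, let $g_0$ be the standard metric and $i$ the standard complex structure, and put $V=V'\times\mathbb C$, $\omega=\omega'\oplus\omega_0$. Let $W\subset V$ be an embedded Lagrangian submanifold without boundary (the image of a smooth embedding $F:N\to V$ of a manifold $N$ with $2\dim N=\dim V$ and $F^*\omega=0$), and let $R$ be a real number such that $|\zeta|\le R$ for all $(x,\zeta)\in W$. Let $D=\{z\in\mathbb C:|z|\le 1\}$ with $z=x+iy$, let $c\in\mathbb C$ be nonzero, and let $v=(v',f):D\to V'\times\mathbb C$ be of class $C^2$ up to the boundary with $$\frac{\partial v'}{\partial x}+J'\frac{\partial v'}{\partial y}=0,\qquad \frac{\partial f}{\partial x}+i\frac{\partial f}{\partial y}=c\quad\text{on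 }D,\qquad v(\partial D)\subset W .$$ Suppose that $v$ is homotopic to a constant map $\{p\}$, $p\in W$, relative to $W$, i.e. through continuous maps $(D,\partial D)\to(V,W)$. Then the energy density of $v$ is integrable on $D$ and $$E(v)=\int_D\Big(\Big|\frac{\partial v'}{\partial x}\Big|_{g'}^2+\Big|\frac{\partial v'}{\partial y}\Big|_{g'}^2+\Big|\frac{\partial f}{\partial x}\Big|^2+\Big|\frac{\partial f}{\partial y}\Big|^2\Big)\,dx\,dy\;\le\;4\pi R^2 .$$ -/

import Mathlib

open Set Topology Manifold Bundle
open scoped ContDiff Manifold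

noncomputable section

section Forms

variable {E : Type*} [NormedAddCommGroup E] [NormedSpace ℝ E]
  {H : Type*} [TopologicalSpace H] (I : ModelWithCorners ℝ E H)
  {M : Type*} [TopologicalSpace M] [ChartedSpace H M]

/-- A (smooth) 1-form on the manifold `M`: a smooth section of the cotangent bundle. -/
structure SmoothOneForm [IsManifold I ∞ M] where
  /-- The value of the form at a point. -/
  toFun (x : M) : TangentSpace I x →L[ℝ] ℝ
  contMDiff : ContMDiff I (I.prod 𝓘(ℝ, E →L[ℝ] ℝ)) ∞
    (fun x ↦ TotalSpace.mk' (E →L[ℝ] ℝ) (E := fun y : M ↦ TangentSpace I y →L[ℝ] ℝ) x (toFun x))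

/-- An almost complex structure on `M`: a smooth field of endomorphisms of the tangent bundle
whose square is `-1`. -/
structure AlmostComplexStructure [IsManifold I ∞ M] where
  /-- The endomorphism of the tangent space at a point. -/
  toFun (x : M) : TangentSpace I x →L[ℝ] TangentSpace I x
  sq (x : M) (u : TangentSpace I x) : toFun x (toFun x u) = -u
  contMDiff : ContMDiff I (I.prod 𝓘(ℝ, E →L[ℝ] E)) ∞
    (fun x ↦ TotalSpace.mk' (E →L[ℝ] E)
      (E := fun y : M ↦ TangentSpace I y →L[ℝ] TangentSpace I y) x (toFun x))

variable {I} [IsManifold I ∞ M]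

/-- The expression of a 1-form in the chart around `x₀`, that is, its pull-back under the inverse
of that chart. -/
def SmoothOneForm.inChart (α : SmoothOneForm I (M := M)) (x₀ : M) (y : E) : E →L[ℝ] ℝ :=
  (α.toFun ((extChartAt I x₀).symm y)).comp
    (mfderivWithin 𝓘(ℝ, E) I (extChartAt I x₀).symm (range I) y)

/-- The exterior derivative `dα` of a 1-form: in a chart,
`(dα)(u, v) = (D α · u)(v) - (D α · v)(u)`. -/
def SmoothOneForm.d (α : SmoothOneForm I (M := M)) (x : M) (u v : TangentSpace I x) : ℝ :=
  let A : E →L[ℝ] E →L[ℝ] ℝ :=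
    fderivWithin ℝ (α.inChart x) (range I) (extChartAt I x x)
  let u' : E := mfderiv I 𝓘(ℝ, E) (extChartAt I x) x u
  let v' : E := mfderiv I 𝓘(ℝ, E) (extChartAt I x) x v
  A u' v' - A v' u'

/-- `α` is the primitive of a symplectic form, that is, `dα` is nondegenerate, so that
`(M, dα)` is an exact symplectic manifold. -/
def SmoothOneForm.IsSymplecticPrimitive (α : SmoothOneForm I (M := M)) : Prop :=
  ∀ (x : M) (u : TangentSpace I x), (∀ v : TangentSpace I x, α.d x u v = 0) → u = 0

/-- The standard symplectic form `dx ∧ dy` on `ℂ = ℝ²`. -/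
def stdSymplectic (a b : ℂ) : ℝ := a.re * b.im - a.im * b.re

/-- The symplectic form `dα ⊕ (dx ∧ dy)` on `M × ℂ`. -/
def SmoothOneForm.prodSymplectic (α : SmoothOneForm I (M := M)) (p : M × ℂ)
    (u v : TangentSpace (I.prod 𝓘(ℝ, ℂ)) p) : ℝ :=
  α.d p.1 (u : E × ℂ).1 (v : E × ℂ).1 + stdSymplectic (u : E × ℂ).2 (v : E × ℂ).2

/-- The metric `g` is adapted to `ω = dα` and `J`: `g = ω(·, J ·)`. As `g` is symmetric and
`J² = -1`, it follows that `J` preserves both `g` and `ω`. -/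
def IsAdaptedMetric
    (g : ContMDiffRiemannianMetric I ∞ E (fun x : M ↦ TangentSpace I x))
    (α : SmoothOneForm I (M := M)) (J : AlmostComplexStructure I (M := M)) : Prop :=
  ∀ (x : M) (u v : TangentSpace I x), g.inner x u v = α.d x u (J.toFun x v)

/-- `F : N → M × ℂ` is a Lagrangian embedding into `(M × ℂ, dα ⊕ dx ∧ dy)`: a smooth embedding
of a manifold of half the dimension, which pulls back the symplectic form to zero. -/
structure IsLagrangianEmbedding {E₁ : Type*} [NormedAddCommGroup E₁] [NormedSpace ℝ E₁]
    {H₁ : Type*} [TopologicalSpace H₁] (I₁ : ModelWithCorners ℝ E₁ H₁)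
    {N : Type*} [TopologicalSpace N] [ChartedSpace H₁ N]
    (α : SmoothOneForm I (M := M)) (F : N → M × ℂ) : Prop where
  isSmoothEmbedding : IsSmoothEmbedding I₁ (I.prod 𝓘(ℝ, ℂ)) ∞ F
  two_mul_dim : 2 * Module.finrank ℝ E₁ = Module.finrank ℝ E + 2
  pullback_eq_zero (y : N) (u v : TangentSpace I₁ y) :
    α.prodSymplectic (F y) (mfderiv I₁ (I.prod 𝓘(ℝ, ℂ)) F y u)
      (mfderiv I₁ (I.prod 𝓘(ℝ, ℂ)) F y v) = 0

end Forms

/-- The closed unit disc `D` in `ℂ`. -/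
def unitDisc : Set ℂ := Metric.closedBall 0 1

section Maps

variable {E : Type*} [NormedAddCommGroup E] [NormedSpace ℝ E]
  {H : Type*} [TopologicalSpace H] (I : ModelWithCorners ℝ E H)
  {M : Type*} [TopologicalSpace M] [ChartedSpace H M]

/-- The partial derivative `∂u/∂x` on the closed disc of a map `u : D → M`. -/
def partialX (u : ℂ → M) (z : ℂ) : TangentSpace I (u z) :=
  mfderivWithin 𝓘(ℝ, ℂ) I u unitDisc z (1 : ℂ)

/-- The partial derivative `∂u/∂y` on the closed disc of a map `u : D → M`. -/
def partialY (u : ℂ → M) (z : ℂ) : TangentSpace I (u z) :=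
  mfderivWithin 𝓘(ℝ, ℂ) I u unitDisc z Complex.I

/-- The map `v : D → X` with `v(∂D) ⊆ W` is homotopic to a constant map `{p}` relative to `W`,
through continuous maps `(D, ∂D) → (X, W)`. -/
def HomotopicToConstRel {X : Type*} [TopologicalSpace X] (v : ℂ → X) (W : Set X) : Prop :=
  ∃ p ∈ W, ∃ h : ℝ × ℂ → X,
    ContinuousOn h (Icc (0 : ℝ) 1 ×ˢ unitDisc) ∧
    (∀ z ∈ unitDisc, h (0, z) = v z) ∧
    (∀ z ∈ unitDisc, h (1, z) = p) ∧
    ∀ t ∈ Icc (0 : ℝ) 1, ∀ z ∈ Metric.sphere (0 : ℂ) 1, h (t, z) ∈ W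

variable {I} [IsManifold I ∞ M]

/-- The perturbed Cauchy-Riemann equations for `v = (v', f) : D → M × ℂ` with boundary in `W`:
`∂v'/∂x + J ∂v'/∂y = 0` and `∂f/∂x + i ∂f/∂y = c` on `D`, and `v(∂D) ⊆ W`. -/
structure SolvesPerturbedCR (J : AlmostComplexStructure I (M := M)) (W : Set (M × ℂ)) (c : ℂ)
    (v' : ℂ → M) (f : ℂ → ℂ) : Prop where
  contMDiffOn_fst : ContMDiffOn 𝓘(ℝ, ℂ) I 2 v' unitDisc
  contDiffOn_snd : ContDiffOn ℝ 2 f unitDisc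
  eq_fst : ∀ z ∈ unitDisc, partialX I v' z + J.toFun (v' z) (partialY I v' z) = 0
  eq_snd : ∀ z ∈ unitDisc,
    fderivWithin ℝ f unitDisc z 1 + Complex.I * fderivWithin ℝ f unitDisc z Complex.I = c
  boundary : ∀ z ∈ Metric.sphere (0 : ℂ) 1, (v' z, f z) ∈ W

/-- The energy density `|∂v/∂x|² + |∂v/∂y|²` of `v = (v', f)` for the metric `g ⊕ g₀` on
`M × ℂ`, with `g₀` the standard metric on `ℂ`. -/
def energyDensity (g : ContMDiffRiemannianMetric I ∞ E (fun x : M ↦ TangentSpace I x))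
    (v' : ℂ → M) (f : ℂ → ℂ) (z : ℂ) : ℝ :=
  g.inner (v' z) (partialX I v' z) (partialX I v' z) +
  g.inner (v' z) (partialY I v' z) (partialY I v' z) +
  ‖fderivWithin ℝ f unitDisc z 1‖ ^ 2 + ‖fderivWithin ℝ f unitDisc z Complex.I‖ ^ 2

end Maps

end

/-! The energy is computed exactly: it equals `π ‖c‖ ^ 2`, and then `‖c‖ ≤ 2 * R`.

For the first claim, the Cauchy-Riemann equation for `v'` and the compatibility of `g`, `ω'` and `J`
make the `M`-part of the density twice the pull-back of `dα` (`IsAdaptedMetric.inner_add_inner_eq`).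
For the `ℂ`-part, the identity `norm_sq_add_norm_sq_eq` gives twice the pull-back of `dx ∧ dy` plus
the defect `‖c‖ ^ 2`. The form `ω` has the primitive `α ⊕ x dy`, so Stokes' theorem
(`integral_unitDisc_curl`) turns the symplectic area into the integral of this primitive over the
boundary loop. On the Lagrangian the primitive restricts to a closed form, and the homotopy,
restricted to the circle, contracts the loop inside it; hence the area is zero
(`integral_boundary_eq_zero`). What remains is `‖c‖ ^ 2` times the area `π` of the disc.

For the second claim, Stokes for the complex form `-i f dz` gives `π c` as a boundary integral of a
function bounded by `R` over a circle of length `2π` (`norm_le_of_cauchyRiemann`).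

All derivatives are taken within the closed disc, so pull-backs must commute with `d` up to the
boundary. Closedness on the Lagrangian is used only through local primitives, so homotopy invariance
holds for merely continuous homotopies. -/

/-! ### Pull-back of one-forms between vector spaces -/

section Calculus

variable {E₂ E G : Type*} [NormedAddCommGroup E₂] [NormedSpace ℝ E₂]
  [NormedAddCommGroup E] [NormedSpace ℝ E] [NormedAddCommGroup G] [NormedSpace ℝ G]

/-- The pull-back of a `C¹` one-form under a `C²` map is `C¹`. -/
theorem ContDiffWithinAt.oneForm_pullback {s : Set E₂} {z : E₂} (hs : UniqueDiffOn ℝ s)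
    (hz : z ∈ s) {w : E₂ → E} (hw : ContDiffWithinAt ℝ 2 w s z) {A : E → E →L[ℝ] G}
    (hA : ContDiffAt ℝ 1 A (w z)) :
    ContDiffWithinAt ℝ 1 (fun y ↦ (A (w y)).comp (fderivWithin ℝ w s y)) s z :=
  (hA.comp_contDiffWithinAt z (hw.of_le (by norm_num))).clm_comp
    (hw.fderivWithin_right hs (by norm_num) hz)

/-- The exterior derivative commutes with pull-backs. -/
theorem fderivWithin_oneForm_pullback_sub {s : Set E₂} {z : E₂} (hs : UniqueDiffOn ℝ s)
    (hz : z ∈ s) (hz' : z ∈ closure (interior s)) {w : E₂ → E}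
    (hw : ContDiffWithinAt ℝ 2 w s z) {A : E → E →L[ℝ] G}
    (hA : DifferentiableAt ℝ A (w z)) (a b : E₂) :
    fderivWithin ℝ (fun y ↦ (A (w y)).comp (fderivWithin ℝ w s y)) s z a b -
      fderivWithin ℝ (fun y ↦ (A (w y)).comp (fderivWithin ℝ w s y)) s z b a =
    fderiv ℝ A (w z) (fderivWithin ℝ w s z a) (fderivWithin ℝ w s z b) -
      fderiv ℝ A (w z) (fderivWithin ℝ w s z b) (fderivWithin ℝ w s z a) := by
  have h1 : DifferentiableWithinAt ℝ w s z := hw.differentiableWithinAt (by norm_num)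
  have h2 : DifferentiableWithinAt ℝ (fderivWithin ℝ w s) s z :=
    (hw.fderivWithin_right (m := 1) hs (by norm_num) hz).differentiableWithinAt (by norm_num)
  have h3 : HasFDerivWithinAt (fun y ↦ A (w y)) ((fderiv ℝ A (w z)).comp (fderivWithin ℝ w s z))
      s z := hA.hasFDerivAt.comp_hasFDerivWithinAt z h1.hasFDerivWithinAt
  have h4 := (h3.clm_comp h2.hasFDerivWithinAt).fderivWithin (hs z hz)
  -- The terms with the second derivative of `w` cancel by symmetry; at boundary points this
  -- symmetry is inherited from nearby interior points.
  have h5 := (hw.isSymmSndFDerivWithinAt (by simp) hs hz' hz) a b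
  rw [h4]
  simp [h5]

end Calculus

/-! ### Stokes' theorem on the closed disc -/

section Disc

theorem uniqueDiffOn_unitDisc : UniqueDiffOn ℝ unitDisc := by
  have h : (interior unitDisc).Nonempty := by
    rw [unitDisc, interior_closedBall _ one_ne_zero]; exact ⟨0, by simp⟩
  exact uniqueDiffOn_convex (convex_closedBall _ _) h

theorem mem_closure_interior_unitDisc {z : ℂ} (hz : z ∈ unitDisc) :
    z ∈ closure (interior unitDisc) := by
  rwa [unitDisc, interior_closedBall _ one_ne_zero, closure_ball _ one_ne_zero]

theorem measurableSet_unitDisc : MeasurableSet unitDisc := Metric.isClosed_closedBall.measurableSet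

theorem isCompact_unitDisc : IsCompact unitDisc := isCompact_closedBall _ _

variable {G : Type*} [NormedAddCommGroup G] [NormedSpace ℝ G]

open Complex MeasureTheory

theorem integral_unitDisc_eq_polar (k : ℂ → G) (hk : ContinuousOn k unitDisc) :
    ∫ z in unitDisc, k z =
      ∫ r in (0 : ℝ)..1, ∫ θ in -Real.pi..Real.pi, r • k (r * exp (θ * I)) := by
  have hpi : -Real.pi ≤ Real.pi := by linarith [Real.pi_pos]
  have hcont : ContinuousOn (fun p : ℝ × ℝ ↦ p.1 • k (p.1 * exp (p.2 * I)))
      (Icc 0 1 ×ˢ Icc (-Real.pi) Real.pi) := by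
    refine continuousOn_fst.smul (hk.comp (by fun_prop) ?_)
    rintro ⟨r, θ⟩ ⟨hr, -⟩
    simpa [unitDisc, Complex.norm_exp_ofReal_mul_I, abs_le] using ⟨by linarith [hr.1], hr.2⟩
  have hint : IntegrableOn (fun p : ℝ × ℝ ↦ p.1 • k (p.1 * exp (p.2 * I)))
      (Ioc 0 1 ×ˢ Ioc (-Real.pi) Real.pi) :=
    (hcont.integrableOn_compact (isCompact_Icc.prod isCompact_Icc)).mono_set
      (prod_mono Ioc_subset_Icc_self Ioc_subset_Icc_self)
  -- The angle interval is made open to match the target of the polar chart.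
  have h1 : ∫ r in (0 : ℝ)..1, ∫ θ in -Real.pi..Real.pi, r • k (r * exp (θ * I)) =
      ∫ p in Ioc (0 : ℝ) 1 ×ˢ Ioo (-Real.pi) Real.pi, p.1 • k (p.1 * exp (p.2 * I)) := by
    rw [intervalIntegral.integral_of_le zero_le_one]
    simp_rw [intervalIntegral.integral_of_le hpi]
    rw [Measure.volume_eq_prod] at hint ⊢
    refine (setIntegral_prod _ hint).symm.trans ?_
    exact setIntegral_congr_set (Measure.set_prod_ae_eq (ae_eq_refl _) Ioo_ae_eq_Ioc.symm)
  rw [h1, ← integral_indicator measurableSet_unitDisc, ← Complex.integral_comp_polarCoord_symm,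
    ← integral_indicator (measurableSet_Ioc.prod measurableSet_Ioo),
    ← integral_indicator (polarCoord.open_target.measurableSet)]
  congr 1
  ext ⟨r, θ⟩
  simp only [polarCoord_target, indicator, mem_prod, mem_Ioi, mem_Ioo, mem_Ioc,
    Complex.polarCoord_symm_apply, unitDisc, Metric.mem_closedBall, dist_zero_right]
  rw [Complex.ofReal_cos, Complex.ofReal_sin, ← exp_mul_I]
  by_cases hr : 0 < r
  · by_cases hr1 : r ≤ 1 <;> by_cases hθ : -Real.pi < θ ∧ θ < Real.pi <;>
      simp [hr, hr1, hθ, Complex.norm_exp_ofReal_mul_I, abs_of_pos]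
  · simp [hr]

/-- Stokes' theorem on the unit disc. -/
theorem integral_unitDisc_curl [CompleteSpace G] (β : ℂ → ℂ →L[ℝ] G)
    (hβ : ContDiffOn ℝ 1 β unitDisc) :
    ∫ z in unitDisc, (fderivWithin ℝ β unitDisc z 1 I - fderivWithin ℝ β unitDisc z I 1) =
      ∫ θ in -Real.pi..Real.pi, β (exp (θ * I)) (I * exp (θ * I)) := by
  have hpi : -Real.pi ≤ Real.pi := by linarith [Real.pi_pos]
  have hβc : ContinuousOn β unitDisc := hβ.continuousOn
  have hβ' : ContinuousOn (fderivWithin ℝ β unitDisc) unitDisc :=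
    hβ.continuousOn_fderivWithin uniqueDiffOn_unitDisc le_rfl
  have hmem : ∀ p ∈ Icc (0 : ℝ) 1 ×ˢ Icc (-Real.pi) Real.pi,
      (p.1 * exp (p.2 * I) : ℂ) ∈ unitDisc := by
    rintro ⟨r, θ⟩ ⟨hr, -⟩
    simpa [unitDisc, Complex.norm_exp_ofReal_mul_I, abs_le] using ⟨by linarith [hr.1], hr.2⟩
  have hcurl : ContinuousOn (fun z ↦ fderivWithin ℝ β unitDisc z 1 I -
      fderivWithin ℝ β unitDisc z I 1) unitDisc := by fun_prop
  rw [integral_unitDisc_eq_polar _ hcurl]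
  let q : ℝ × ℝ → ℂ := fun p ↦ p.1 * exp (p.2 * I)
  let e : ℝ × ℝ → ℂ := fun p ↦ exp (p.2 * I)
  let dq : ℝ × ℝ → ℝ × ℝ →L[ℝ] ℂ := fun p ↦
    (ContinuousLinearMap.fst ℝ ℝ ℝ).smulRight (exp (p.2 * I)) +
      (ContinuousLinearMap.snd ℝ ℝ ℝ).smulRight (p.1 • (I * exp (p.2 * I)))
  let de : ℝ × ℝ → ℝ × ℝ →L[ℝ] ℂ := fun p ↦
    (ContinuousLinearMap.snd ℝ ℝ ℝ).smulRight (I * exp (p.2 * I))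
  have he : ∀ p, HasFDerivAt e (de p) p := by
    intro p
    have h1 : HasDerivAt (fun t : ℝ ↦ exp (t * I)) (I * exp (p.2 * I)) p.2 := by
      have := ((Complex.ofRealCLM.hasDerivAt (x := p.2)).mul_const I).cexp
      simpa [mul_comm] using this
    exact h1.hasFDerivAt.comp p (hasFDerivAt_snd (𝕜 := ℝ) (p := p))
  have hq : ∀ p, HasFDerivAt q (dq p) p := by
    intro p
    have h0 : HasFDerivAt (fun p : ℝ × ℝ ↦ (p.1 : ℂ))
        (Complex.ofRealCLM.comp (ContinuousLinearMap.fst ℝ ℝ ℝ)) p :=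
      Complex.ofRealCLM.hasFDerivAt.comp p (hasFDerivAt_fst (𝕜 := ℝ) (p := p))
    refine (h0.mul (he p)).congr_fderiv ?_
    ext <;> simp [dq, de, e]
  -- the components of the pull-back
  let P : ℝ × ℝ → G := fun p ↦ β (q p) (p.1 • (I * e p))
  let Q : ℝ × ℝ → G := fun p ↦ -β (q p) (e p)
  let P' : ℝ × ℝ → ℝ × ℝ →L[ℝ] G := fun p ↦
    fderiv ℝ P p
  let Q' : ℝ × ℝ → ℝ × ℝ →L[ℝ] G := fun p ↦ fderiv ℝ Q p
  have hball : ∀ p ∈ Ioo (0 : ℝ) 1 ×ˢ Ioo (-Real.pi) Real.pi, q p ∈ Metric.ball (0 : ℂ) 1 := by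
    rintro ⟨r, θ⟩ ⟨hr, -⟩
    simpa [q, Complex.norm_exp_ofReal_mul_I, abs_lt] using ⟨by linarith [hr.1], hr.2⟩
  have hβq : ∀ p ∈ Ioo (0 : ℝ) 1 ×ˢ Ioo (-Real.pi) Real.pi,
      HasFDerivAt (fun p ↦ β (q p)) ((fderivWithin ℝ β unitDisc (q p)).comp (dq p)) p := by
    intro p hp
    have hn : unitDisc ∈ 𝓝 (q p) :=
      Filter.mem_of_superset (Metric.isOpen_ball.mem_nhds (hball p hp)) Metric.ball_subset_closedBall
    have h1 : HasFDerivAt β (fderivWithin ℝ β unitDisc (q p)) (q p) :=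
      ((hβ.differentiableOn (by norm_num)) _ (mem_of_mem_nhds hn)).hasFDerivWithinAt.hasFDerivAt hn
    exact h1.comp p (hq p)
  have hP : ∀ p ∈ Ioo (0 : ℝ) 1 ×ˢ Ioo (-Real.pi) Real.pi, HasFDerivAt P
      ((β (q p)).comp (p.1 • (ContinuousLinearMap.mul ℝ ℂ I).comp (de p) +
        (ContinuousLinearMap.fst ℝ ℝ ℝ).smulRight (I * e p)) +
       (((fderivWithin ℝ β unitDisc (q p)).comp (dq p)).flip (p.1 • (I * e p)))) p := by
    intro p hp
    have h1 : HasFDerivAt (fun p ↦ I * e p) ((ContinuousLinearMap.mul ℝ ℂ I).comp (de p)) p :=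
      (ContinuousLinearMap.mul ℝ ℂ I).hasFDerivAt.comp p (he p)
    exact (hβq p hp).clm_apply ((hasFDerivAt_fst (𝕜 := ℝ) (p := p)).smul h1)
  have hQ : ∀ p ∈ Ioo (0 : ℝ) 1 ×ˢ Ioo (-Real.pi) Real.pi, HasFDerivAt Q
      (-((β (q p)).comp (de p) +
       (((fderivWithin ℝ β unitDisc (q p)).comp (dq p)).flip (e p)))) p := by
    intro p hp
    exact ((hβq p hp).clm_apply (he p)).neg
  -- In polar coordinates the pull-back of `β` is `-Q dr + P dθ`, so the divergence of `(P, Q)` is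
  -- its curl. The terms with `β` undifferentiated cancel, and the Jacobian leaves the factor `r`.
  have hdiv : ∀ p ∈ Ioo (0 : ℝ) 1 ×ˢ Ioo (-Real.pi) Real.pi, P' p (1, 0) + Q' p (0, 1) =
      p.1 • (fderivWithin ℝ β unitDisc (q p) 1 I - fderivWithin ℝ β unitDisc (q p) I 1) := by
    intro p hp
    simp only [P', Q', (hP p hp).fderiv, (hQ p hp).fderiv]
    -- The antisymmetrization of `L` is an area form, and the frame `(a, I * a)` has determinant
    -- `‖a‖ ^ 2`.
    have key : ∀ a : ℂ, ∀ L : ℂ →L[ℝ] ℂ →L[ℝ] G,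
        L a (I * a) - L (I * a) a = (‖a‖ ^ 2) • (L 1 I - L I 1) := by
      intro a L
      have ha : a = a.re • (1 : ℂ) + a.im • I := by simp [Complex.re_add_im]
      have hIa : I * a = (-a.im) • (1 : ℂ) + a.re • I := by
        apply Complex.ext <;> simp
      have hn : ‖a‖ ^ 2 = a.re ^ 2 + a.im ^ 2 := by
        rw [← Complex.normSq_eq_norm_sq, Complex.normSq_apply]; ring
      rw [hn, hIa]
      conv_lhs => rw [ha]
      simp only [map_add, map_smul, add_apply, smul_apply]
      simp
      module
    have h1 := key (e p) (fderivWithin ℝ β unitDisc (q p))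
    have h2 : ‖e p‖ = 1 := Complex.norm_exp_ofReal_mul_I _
    rw [h2] at h1
    simp only [one_pow, one_smul] at h1
    rw [← h1]
    simp [dq, de, smul_sub, e, -Complex.real_smul]
    abel
  have hPc : ContinuousOn P (Icc 0 1 ×ˢ Icc (-Real.pi) Real.pi) := by
    have : ContinuousOn (fun p ↦ β (q p)) (Icc 0 1 ×ˢ Icc (-Real.pi) Real.pi) :=
      hβc.comp (by fun_prop) hmem
    exact this.clm_apply (by fun_prop)
  have hQc : ContinuousOn Q (Icc 0 1 ×ˢ Icc (-Real.pi) Real.pi) := by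
    have : ContinuousOn (fun p ↦ β (q p)) (Icc 0 1 ×ˢ Icc (-Real.pi) Real.pi) :=
      hβc.comp (by fun_prop) hmem
    exact (this.clm_apply (by fun_prop)).neg
  have hK : ContinuousOn (fun p : ℝ × ℝ ↦ p.1 • (fderivWithin ℝ β unitDisc (q p) 1 I -
      fderivWithin ℝ β unitDisc (q p) I 1)) (Icc 0 1 ×ˢ Icc (-Real.pi) Real.pi) :=
    continuousOn_fst.smul (hcurl.comp (by fun_prop) hmem)
  have hIoo : (Icc (0 : ℝ) 1 ×ˢ Icc (-Real.pi) Real.pi : Set (ℝ × ℝ)) =ᵐ[volume]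
      (Ioo (0 : ℝ) 1 ×ˢ Ioo (-Real.pi) Real.pi : Set (ℝ × ℝ)) := by
    rw [Measure.volume_eq_prod]
    exact Measure.set_prod_ae_eq Ioo_ae_eq_Icc.symm Ioo_ae_eq_Icc.symm
  have hint : IntegrableOn (fun p ↦ P' p (1, 0) + Q' p (0, 1))
      (Icc 0 1 ×ˢ Icc (-Real.pi) Real.pi) := by
    rw [integrableOn_congr_set_ae hIoo]
    refine IntegrableOn.congr_fun ?_ (fun p hp ↦ (hdiv p hp).symm)
      (measurableSet_Ioo.prod measurableSet_Ioo)
    exact (hK.integrableOn_compact (isCompact_Icc.prod isCompact_Icc)).mono_set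
      (prod_mono Ioo_subset_Icc_self Ioo_subset_Icc_self)
  have main := integral2_divergence_prod_of_hasFDerivAt_off_countable P Q P' Q' 0 (-Real.pi)
    1 Real.pi ∅ countable_empty (by rwa [uIcc_of_le zero_le_one, uIcc_of_le hpi])
    (by rwa [uIcc_of_le zero_le_one, uIcc_of_le hpi])
    (fun p hp ↦ by
      simp only [min_eq_left zero_le_one, max_eq_right zero_le_one, min_eq_left hpi,
        max_eq_right hpi, sdiff_empty] at hp
      exact (hP p hp).differentiableAt.hasFDerivAt)
    (fun p hp ↦ by
      simp only [min_eq_left zero_le_one, max_eq_right zero_le_one, min_eq_left hpi,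
        max_eq_right hpi, sdiff_empty] at hp
      exact (hQ p hp).differentiableAt.hasFDerivAt)
    (by rwa [uIcc_of_le zero_le_one, uIcc_of_le hpi])
  have hlhs : ∫ r in (0 : ℝ)..1, ∫ θ in -Real.pi..Real.pi,
      r • (fderivWithin ℝ β unitDisc (r * exp (θ * I)) 1 I -
        fderivWithin ℝ β unitDisc (r * exp (θ * I)) I 1) =
      ∫ r in (0 : ℝ)..1, ∫ θ in -Real.pi..Real.pi, P' (r, θ) (1, 0) + Q' (r, θ) (0, 1) := by
    rw [intervalIntegral.integral_of_le zero_le_one, intervalIntegral.integral_of_le zero_le_one,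
      integral_Ioc_eq_integral_Ioo, integral_Ioc_eq_integral_Ioo]
    refine setIntegral_congr_fun measurableSet_Ioo fun r hr ↦ ?_
    rw [intervalIntegral.integral_of_le hpi, intervalIntegral.integral_of_le hpi,
      integral_Ioc_eq_integral_Ioo, integral_Ioc_eq_integral_Ioo]
    exact setIntegral_congr_fun measurableSet_Ioo fun θ hθ ↦ (hdiv (r, θ) ⟨hr, hθ⟩).symm
  rw [hlhs, main]
  -- Of the four edges of the rectangle, the two at `θ = ±π` cancel, the one at `r = 0` vanishes
  -- through the factor `r` in `P`, and the one at `r = 1` is the boundary integral.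
  have e1 : ∀ r : ℝ, Q (r, Real.pi) = Q (r, -Real.pi) := by
    intro r
    simp [Q, q, e, Complex.exp_neg]
  have e2 : ∀ θ : ℝ, P (0, θ) = 0 := by intro θ; simp [P]
  have e3 : ∀ θ : ℝ, P (1, θ) = β (exp (θ * I)) (I * exp (θ * I)) := by
    intro θ; simp [P, q, e]
  simp [e1, e2, e3]

end Disc

/-! ### Pull-back of one-forms on manifolds, via charts -/

section Pullback

variable {E : Type*} [NormedAddCommGroup E] [NormedSpace ℝ E]
  {H : Type*} [TopologicalSpace H] {I : ModelWithCorners ℝ E H} [I.Boundaryless]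
  {M : Type*} [TopologicalSpace M] [ChartedSpace H M] [IsManifold I ∞ M]
  {E₂ : Type*} [NormedAddCommGroup E₂] [NormedSpace ℝ E₂]

/-- Smoothness of a section means smoothness in the trivialization at `x₀`, and the inverse of the
tangent bundle trivialization is the derivative of the inverse chart; so the trivialized form is the
form in the chart. -/
theorem SmoothOneForm.contDiffAt_inChart (α : SmoothOneForm I (M := M)) (x₀ : M) :
    ContDiffAt ℝ ∞ (α.inChart x₀) (extChartAt I x₀ x₀) := by
  have h1 := ((contMDiffAt_hom_bundle _).1 (α.contMDiff x₀)).2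
  have h2 : ContMDiffAt 𝓘(ℝ, E) I ∞ (extChartAt I x₀).symm (extChartAt I x₀ x₀) :=
    (contMDiffOn_extChartAt_symm x₀).contMDiffAt (extChartAt_target_mem_nhds x₀)
  have h3 : (extChartAt I x₀).symm (extChartAt I x₀ x₀) = x₀ := extChartAt_to_inv x₀
  have h4 := (ContMDiffAt.comp (extChartAt I x₀ x₀) (by rw [h3]; exact h1) h2).contDiffAt
  refine h4.congr_of_eventuallyEq ?_
  filter_upwards [extChartAt_target_mem_nhds (I := I) x₀] with y hy
  have hy' : (extChartAt I x₀).symm y ∈ (chartAt H x₀).source := by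
    simpa using (extChartAt I x₀).map_target hy
  ext b
  simp only [SmoothOneForm.inChart, Function.comp_apply, ContinuousLinearMap.inCoordinates]
  rw [TangentBundle.symmL_trivializationAt hy', (extChartAt I x₀).right_inv hy]
  simp

/-- The pull-back of a one-form under a map defined on a subset of a vector space. -/
noncomputable def SmoothOneForm.pullback (α : SmoothOneForm I (M := M)) (u : E₂ → M) (s : Set E₂)
    (z : E₂) : E₂ →L[ℝ] ℝ :=
  (α.toFun (u z)).comp (mfderivWithin 𝓘(ℝ, E₂) I u s z)

omit [I.Boundaryless] in
theorem fderivWithin_extChartAt_comp {u : E₂ → M} {s : Set E₂} {z : E₂} (x₀ : M)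
    (hs : UniqueDiffWithinAt ℝ s z) (hu : MDifferentiableWithinAt 𝓘(ℝ, E₂) I u s z)
    (hz : u z ∈ (chartAt H x₀).source) :
    fderivWithin ℝ (fun y ↦ extChartAt I x₀ (u y)) s z =
      (mfderiv I 𝓘(ℝ, E) (extChartAt I x₀) (u z)).comp (mfderivWithin 𝓘(ℝ, E₂) I u s z) := by
  rw [← mfderivWithin_eq_fderivWithin]
  exact mfderiv_comp_mfderivWithin z (mdifferentiableAt_extChartAt hz) hu hs.uniqueMDiffWithinAt

-- Inserting the chart and its inverse between `u` and `α` changes nothing where `u` stays in the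
-- chart domain. This reduces pull-backs to `M` to the vector space case.
omit [I.Boundaryless] in
theorem SmoothOneForm.pullback_eventuallyEq (α : SmoothOneForm I (M := M)) {u : E₂ → M}
    {s : Set E₂} (hs : UniqueDiffOn ℝ s) (hu : ContMDiffOn 𝓘(ℝ, E₂) I 2 u s) {z₀ : E₂}
    (hz₀ : z₀ ∈ s) :
    α.pullback u s =ᶠ[𝓝[s] z₀] fun y ↦ (α.inChart (u z₀) (extChartAt I (u z₀) (u y))).comp
      (fderivWithin ℝ (fun y ↦ extChartAt I (u z₀) (u y)) s y) := by
  have hc : ∀ᶠ y in 𝓝[s] z₀, u y ∈ (chartAt H (u z₀)).source :=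
    (hu.continuousOn z₀ hz₀) ((chartAt H (u z₀)).open_source.mem_nhds (mem_chart_source H (u z₀)))
  filter_upwards [hc, self_mem_nhdsWithin] with y hy hys
  rw [fderivWithin_extChartAt_comp (u z₀) (hs y hys)
    (hu.mdifferentiableOn (by norm_num) y hys) hy]
  have hy' : u y ∈ (extChartAt I (u z₀)).source := by simpa using hy
  have h1 := mfderivWithin_extChartAt_symm_comp_mfderiv_extChartAt' hy'
  ext b
  have h2 := DFunLike.congr_fun h1 (mfderivWithin 𝓘(ℝ, E₂) I u s y b)
  have h3 := (extChartAt I (u z₀)).left_inv hy'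
  simp only [SmoothOneForm.inChart, SmoothOneForm.pullback, ContinuousLinearMap.comp_apply] at h2 ⊢
  rw [h3]
  exact congrArg _ h2.symm

omit [I.Boundaryless] [IsManifold I ∞ M] in
theorem ContMDiffOn.contDiffWithinAt_extChartAt_comp {u : E₂ → M} {s : Set E₂}
    (hu : ContMDiffOn 𝓘(ℝ, E₂) I 2 u s) {z : E₂} (hz : z ∈ s) :
    ContDiffWithinAt ℝ 2 (fun y ↦ extChartAt I (u z) (u y)) s z := by
  have h : ContMDiffAt I 𝓘(ℝ, E) 2 (extChartAt I (u z)) (u z) := contMDiffAt_extChartAt.of_le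
    (by exact_mod_cast le_top)
  exact (h.comp_contMDiffWithinAt z (hu z hz)).contDiffWithinAt

theorem SmoothOneForm.contDiffOn_pullback (α : SmoothOneForm I (M := M)) {u : E₂ → M}
    {s : Set E₂} (hs : UniqueDiffOn ℝ s) (hu : ContMDiffOn 𝓘(ℝ, E₂) I 2 u s) :
    ContDiffOn ℝ 1 (α.pullback u s) s := by
  intro z hz
  refine ContDiffWithinAt.congr_of_eventuallyEq_of_mem ?_ (α.pullback_eventuallyEq hs hu hz) hz
  exact (hu.contDiffWithinAt_extChartAt_comp hz).oneForm_pullback hs hz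
    ((α.contDiffAt_inChart (u z)).of_le (by exact_mod_cast le_top))

theorem SmoothOneForm.fderivWithin_pullback_sub (α : SmoothOneForm I (M := M)) {u : E₂ → M}
    {s : Set E₂} (hs : UniqueDiffOn ℝ s) (hu : ContMDiffOn 𝓘(ℝ, E₂) I 2 u s) {z : E₂}
    (hz : z ∈ s) (hz' : z ∈ closure (interior s)) (a b : E₂) :
    fderivWithin ℝ (α.pullback u s) s z a b - fderivWithin ℝ (α.pullback u s) s z b a =
      α.d (u z) (mfderivWithin 𝓘(ℝ, E₂) I u s z a) (mfderivWithin 𝓘(ℝ, E₂) I u s z b) := by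
  rw [(α.pullback_eventuallyEq hs hu hz).fderivWithin_eq_of_mem hz,
    fderivWithin_oneForm_pullback_sub hs hz hz' (hu.contDiffWithinAt_extChartAt_comp hz)
    ((α.contDiffAt_inChart (u z)).differentiableAt (by simp)),
    fderivWithin_extChartAt_comp (u z) (hs z hz)
    (hu.mdifferentiableOn (by norm_num) z hz) (mem_chart_source H (u z))]
  simp only [SmoothOneForm.d, I.range_eq_univ, fderivWithin_univ]
  rfl

end Pullback

/-! ### The primitive `x dy` of the area form -/

section Linear

variable {E₂ : Type*} [NormedAddCommGroup E₂] [NormedSpace ℝ E₂]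

/-- The one-form `x dy` on `ℂ`. -/
noncomputable def liouvilleForm (ζ : ℂ) : ℂ →L[ℝ] ℝ := ζ.re • Complex.imCLM

theorem contDiff_liouvilleForm {n : ℕ∞ω} : ContDiff ℝ n liouvilleForm :=
  Complex.reCLM.contDiff.smul contDiff_const

theorem fderiv_liouvilleForm_sub (ζ a b : ℂ) :
    fderiv ℝ liouvilleForm ζ a b - fderiv ℝ liouvilleForm ζ b a = stdSymplectic a b := by
  have h : HasFDerivAt liouvilleForm (Complex.reCLM.smulRight Complex.imCLM) ζ :=
    (Complex.reCLM.smulRight Complex.imCLM : ℂ →L[ℝ] ℂ →L[ℝ] ℝ).hasFDerivAt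
  rw [h.fderiv]
  simp [stdSymplectic]
  ring

/-- The pull-back of the form `x dy`. -/
noncomputable def liouvillePullback (f : E₂ → ℂ) (s : Set E₂) (z : E₂) : E₂ →L[ℝ] ℝ :=
  (liouvilleForm (f z)).comp (fderivWithin ℝ f s z)

theorem contDiffOn_liouvillePullback {f : E₂ → ℂ} {s : Set E₂} (hs : UniqueDiffOn ℝ s)
    (hf : ContDiffOn ℝ 2 f s) : ContDiffOn ℝ 1 (liouvillePullback f s) s := fun z hz ↦
  (hf z hz).oneForm_pullback hs hz contDiff_liouvilleForm.contDiffAt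

theorem fderivWithin_liouvillePullback_sub {f : E₂ → ℂ} {s : Set E₂} (hs : UniqueDiffOn ℝ s)
    (hf : ContDiffOn ℝ 2 f s) {z : E₂} (hz : z ∈ s) (hz' : z ∈ closure (interior s)) (a b : E₂) :
    fderivWithin ℝ (liouvillePullback f s) s z a b - fderivWithin ℝ (liouvillePullback f s) s z b a =
      stdSymplectic (fderivWithin ℝ f s z a) (fderivWithin ℝ f s z b) :=
  (fderivWithin_oneForm_pullback_sub hs hz hz' (hf z hz)
    (contDiff_liouvilleForm (n := 1).differentiable (by norm_num) _) a b).trans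
      (fderiv_liouvilleForm_sub _ _ _)

end Linear

/-! ### Homotopy invariance through local primitives -/

section Homotopy

open unitInterval

variable {X : Type*} [TopologicalSpace X]

/-- Along the path the difference of the two primitives is locally constant, hence constant on the
connected interval. The increment along an edge thus does not depend on the cell whose primitive is
used. -/
theorem sub_eq_sub_of_eventually_sub_const {U U' : Set X} {s s' : X → ℝ}
    (hs : ∀ y ∈ U ∩ U', ∀ᶠ x in 𝓝 y, s x - s' x = s y - s' y) {γ : I → X} (hγ : Continuous γ)
    {a b : I} (hab : a ≤ b) (hU : ∀ t ∈ Icc a b, γ t ∈ U) (hU' : ∀ t ∈ Icc a b, γ t ∈ U') :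
    s (γ b) - s (γ a) = s' (γ b) - s' (γ a) := by
  have h := (isPreconnected_Icc (a := a) (b := b)).induction₂
    (fun x y ↦ s (γ x) - s' (γ x) = s (γ y) - s' (γ y))
    (fun x hx ↦ nhdsWithin_le_nhds ((hγ.continuousAt.eventually
      (hs (γ x) ⟨hU x hx, hU' x hx⟩)).mono fun y hy ↦ hy.symm))
    (fun x y z _ _ _ h1 h2 ↦ h1.trans h2) (fun x y _ _ h ↦ h.symm)
    (left_mem_Icc.2 hab) (right_mem_Icc.2 hab)
  linarith

/-- Homotopy invariance of the integral of a closed one-form, which is given by its local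
primitives: the integral over a null-homotopic loop vanishes. -/
theorem eq_of_nullhomotopic_of_localPrimitives (P : Set X → (X → ℝ) → Prop)
    (hopen : ∀ U s, P U s → IsOpen U) (hcover : ∀ y, ∃ U s, P U s ∧ y ∈ U)
    (hcompat : ∀ U s U' s', P U s → P U' s' → ∀ y ∈ U ∩ U', ∀ᶠ x in 𝓝 y, s x - s' x = s y - s' y)
    (K : I × I → X) (hK : Continuous K) (hloop : ∀ t, K (t, 0) = K (t, 1))
    (p : X) (hp : ∀ θ, K (1, θ) = p) (L : I → ℝ)
    (hL : ∀ U s, P U s → ∀ a b : I, a ≤ b → (∀ θ ∈ Icc a b, K (0, θ) ∈ U) →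
      s (K (0, b)) - s (K (0, a)) = L b - L a) :
    L 0 = L 1 := by
  -- A grid so fine that `K` sends each cell into the domain of one primitive; `t` equals `1` from
  -- index `B` on.
  obtain ⟨t, ht0, htm, ⟨B, hB⟩, hcell⟩ :=
    exists_monotone_Icc_subset_open_cover_unitInterval_prod_self
      (c := fun i : {i : Set X × (X → ℝ) // P i.1 i.2} ↦ K ⁻¹' i.1.1)
      (fun i ↦ (hopen _ _ i.2).preimage hK)
      (fun q _ ↦ by
        obtain ⟨U, s, h, hq⟩ := hcover (K q)
        exact mem_iUnion.2 ⟨⟨(U, s), h⟩, hq⟩)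
  choose i hi using hcell
  have hstep : ∀ n, t n ≤ t (n + 1) := fun n ↦ htm n.le_succ
  have hmem : ∀ n m x y, x ∈ Icc (t n) (t (n + 1)) → y ∈ Icc (t m) (t (m + 1)) →
      K (x, y) ∈ (i n m).1.1 := fun n m x y hx hy ↦ hi n m ⟨hx, hy⟩
  have hKv : ∀ y, Continuous fun x ↦ K (x, y) := fun y ↦ by fun_prop
  have hKh : ∀ x, Continuous fun y ↦ K (x, y) := fun x ↦ by fun_prop
  have hl : ∀ n, t n ∈ Icc (t n) (t (n + 1)) := fun n ↦ left_mem_Icc.2 (hstep n)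
  have hr : ∀ n, t (n + 1) ∈ Icc (t n) (t (n + 1)) := fun n ↦ right_mem_Icc.2 (hstep n)
  let pr : ℕ → ℕ → X → ℝ := fun n m ↦ (i n m).1.2
  let bot : ℕ → ℕ → ℝ := fun n m ↦ pr n m (K (t n, t (m + 1))) - pr n m (K (t n, t m))
  let lft : ℕ → ℕ → ℝ := fun n m ↦ pr n m (K (t (n + 1), t m)) - pr n m (K (t n, t m))
  have hside : ∀ n m, pr n m (K (t (n + 1), t (m + 1))) - pr n m (K (t n, t (m + 1))) =
      lft n (m + 1) := fun n m ↦
    sub_eq_sub_of_eventually_sub_const (hcompat _ _ _ _ (i n m).2 (i n (m + 1)).2)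
      (hKv (t (m + 1))) (hstep n) (fun x hx ↦ hmem n m x _ hx (hr m))
      (fun x hx ↦ hmem n (m + 1) x _ hx (hl (m + 1)))
  have htop : ∀ n m, pr n m (K (t (n + 1), t (m + 1))) - pr n m (K (t (n + 1), t m)) =
      bot (n + 1) m := fun n m ↦
    sub_eq_sub_of_eventually_sub_const (hcompat _ _ _ _ (i n m).2 (i (n + 1) m).2)
      (hKh (t (n + 1))) (hstep m) (fun x hx ↦ hmem n m _ x (hr n) hx)
      (fun x hx ↦ hmem (n + 1) m _ x (hl (n + 1)) hx)
  -- The left and right sides of the square trace the same path since each `K (t, ·)` is a loop,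
  -- though their increments are computed with different primitives.
  have hclosed : ∀ n, lft n (B + 1) = lft n 0 := by
    intro n
    have h1 : t (B + 1) = 1 := hB _ (Nat.le_succ B)
    have h2 : ∀ x, K (x, t (B + 1)) = K (x, t 0) := fun x ↦ by rw [h1, ht0, hloop]
    have h3 := sub_eq_sub_of_eventually_sub_const
      (hcompat _ _ _ _ (i n (B + 1)).2 (i n 0).2) (hKv (t 0)) (hstep n)
      (fun x hx ↦ by rw [← h2]; exact hmem n (B + 1) x _ hx (hl (B + 1)))
      (fun x hx ↦ hmem n 0 x _ hx (hl 0))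
    simp only [lft, h2]
    exact h3
  -- Around each cell the increments of its primitive add up to zero. Summed over a row, the
  -- vertical edges telescope to the two sides of the square, which cancel.
  have hrow : ∀ n, ∑ m ∈ Finset.range (B + 1), bot (n + 1) m =
      ∑ m ∈ Finset.range (B + 1), bot n m := by
    intro n
    have h : ∀ m, bot (n + 1) m = bot n m + (lft n (m + 1) - lft n m) := by
      intro m
      rw [← htop, ← hside]
      simp only [bot, lft]
      ring
    simp_rw [h, Finset.sum_add_distrib, Finset.sum_range_sub, hclosed, sub_self, add_zero]
  have hall : ∀ n, ∑ m ∈ Finset.range (B + 1), bot n m =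
      ∑ m ∈ Finset.range (B + 1), bot 0 m := fun n ↦ by
    induction n with
    | zero => rfl
    | succ n ih => rw [hrow, ih]
  -- At height `B` the homotopy has reached the constant loop; at height `0` the sum is the total
  -- increment of `L`.
  have h0 : ∑ m ∈ Finset.range (B + 1), bot B m = 0 :=
    Finset.sum_eq_zero fun m _ ↦ by simp [bot, hB B le_rfl, hp]
  have h1 : ∑ m ∈ Finset.range (B + 1), bot 0 m = L 1 - L 0 := by
    have h : ∀ m, bot 0 m = L (t (m + 1)) - L (t m) := fun m ↦ by
      have := hL _ _ (i 0 m).2 (t m) (t (m + 1)) (hstep m)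
        (fun θ hθ ↦ by rw [← ht0]; exact hmem 0 m _ _ (hl 0) hθ)
      simpa only [bot, ht0] using this
    simp_rw [h, Finset.sum_range_sub fun m ↦ L (t m), ht0, hB (B + 1) (Nat.le_succ B)]
  linarith [hall B]

end Homotopy

theorem two_le_infty : (2 : ℕ∞ω) ≤ ∞ := 
  WithTop.coe_le_coe.2 (le_top : (2 : ℕ∞) ≤ ⊤)

/-! ### Uniqueness of local primitives up to constants -/

section LocalPrimitive

variable {E₁ : Type*} [NormedAddCommGroup E₁] [NormedSpace ℝ E₁]
    {H₁ : Type*} [TopologicalSpace H₁] {I₁ : ModelWithCorners ℝ E₁ H₁} [I₁.Boundaryless]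
    {N : Type*} [TopologicalSpace N] [ChartedSpace H₁ N] [IsManifold I₁ ∞ N]

/-- A function with vanishing derivative is locally constant. -/
theorem eventually_sub_eq_of_hasMFDerivAt {U U' : Set N} (hU : IsOpen U) (hU' : IsOpen U')
    {s s' : N → ℝ} {β : ∀ y : N, TangentSpace I₁ y →L[ℝ] ℝ}
    (hs : ∀ y ∈ U, HasMFDerivAt I₁ 𝓘(ℝ, ℝ) s y (β y))
    (hs' : ∀ y ∈ U', HasMFDerivAt I₁ 𝓘(ℝ, ℝ) s' y (β y)) (y : N) (hy : y ∈ U ∩ U') :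
    ∀ᶠ x in 𝓝 y, s x - s' x = s y - s' y := by
  let ψ := extChartAt I₁ y
  have h1 : ∀ᶠ z in 𝓝 (ψ y), z ∈ ψ.target ∧ ψ.symm z ∈ U ∩ U' := by
    refine Filter.Eventually.and (extChartAt_target_mem_nhds y) ?_
    have := (continuousAt_extChartAt_symm (I := I₁) y)
    refine this.eventually ?_
    rw [extChartAt_to_inv]
    exact (hU.inter hU').mem_nhds hy
  obtain ⟨ε, hε, hball⟩ := Metric.eventually_nhds_iff_ball.1 h1
  have hd : ∀ z ∈ Metric.ball (ψ y) ε,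
      HasFDerivWithinAt (fun z ↦ s (ψ.symm z) - s' (ψ.symm z)) (0 : E₁ →L[ℝ] ℝ)
        (Metric.ball (ψ y) ε) z := by
    intro z hz
    obtain ⟨hz1, hz2⟩ := hball z hz
    have h2 : HasMFDerivAt 𝓘(ℝ, E₁) I₁ ψ.symm z (mfderiv 𝓘(ℝ, E₁) I₁ ψ.symm z) :=
      MDifferentiableAt.hasMFDerivAt (((contMDiffOn_extChartAt_symm (n := 1) y).contMDiffAt
        ((isOpen_extChartAt_target y).mem_nhds hz1)).mdifferentiableAt (by norm_num))
    have h3 := ((hs _ hz2.1).comp z h2).hasFDerivAt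
    have h4 := ((hs' _ hz2.2).comp z h2).hasFDerivAt
    have h5 := (h3.sub h4).hasFDerivWithinAt (s := Metric.ball (ψ y) ε)
    exact h5.congr_fderiv (sub_self _)
  have hconst : ∀ z ∈ Metric.ball (ψ y) ε, s (ψ.symm z) - s' (ψ.symm z) =
      s (ψ.symm (ψ y)) - s' (ψ.symm (ψ y)) := fun z hz ↦
    (convex_ball _ _).is_const_of_fderivWithin_eq_zero (𝕜 := ℝ)
      (f := fun z ↦ s (ψ.symm z) - s' (ψ.symm z))
      (fun z hz ↦ (hd z hz).differentiableWithinAt)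
      (fun z hz ↦ (hd z hz).fderivWithin (Metric.isOpen_ball.uniqueDiffWithinAt hz)) hz
      (Metric.mem_ball_self hε)
  have hc : ∀ᶠ x in 𝓝 y, ψ x ∈ Metric.ball (ψ y) ε :=
    (continuousAt_extChartAt y).eventually (Metric.ball_mem_nhds _ hε)
  filter_upwards [hc, extChartAt_source_mem_nhds (I := I₁) y] with x hx hxs
  have := hconst (ψ x) hx
  rwa [ψ.left_inv hxs, ψ.left_inv (mem_extChartAt_source y)] at this

end LocalPrimitive

/-! ### Closedness of the primitive on a Lagrangian -/

section Lagrangian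

variable {E : Type*} [NormedAddCommGroup E] [NormedSpace ℝ E]
    {H : Type*} [TopologicalSpace H] {I : ModelWithCorners ℝ E H} [I.Boundaryless]
    {M : Type*} [TopologicalSpace M] [ChartedSpace H M] [IsManifold I ∞ M]
    {E₁ : Type*} [NormedAddCommGroup E₁] [NormedSpace ℝ E₁]
    {H₁ : Type*} [TopologicalSpace H₁] {I₁ : ModelWithCorners ℝ E₁ H₁} [I₁.Boundaryless]
    {N : Type*} [TopologicalSpace N] [ChartedSpace H₁ N] [IsManifold I₁ ∞ N]

variable (I₁) in
/-- The pull-back of `α ⊕ x dy` under a map `N → M × ℂ`. -/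
noncomputable def SmoothOneForm.prodPullback (α : SmoothOneForm I (M := M)) (F : N → M × ℂ) (y : N) :
    TangentSpace I₁ y →L[ℝ] ℝ :=
  (α.toFun (F y).1).comp (mfderiv I₁ I (fun y ↦ (F y).1) y) +
    (liouvilleForm (F y).2).comp (mfderiv I₁ 𝓘(ℝ, ℂ) (fun y ↦ (F y).2) y)

/-- A map pulling back `dα ⊕ dx ∧ dy` to zero pulls back `α ⊕ x dy` to a form that has local
primitives. -/
theorem SmoothOneForm.exists_localPrimitive (α : SmoothOneForm I (M := M)) {F : N → M × ℂ}
    (hF : ContMDiff I₁ (I.prod 𝓘(ℝ, ℂ)) ∞ F)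
    (hω : ∀ (y : N) (u v : TangentSpace I₁ y),
      α.prodSymplectic (F y) (mfderiv I₁ (I.prod 𝓘(ℝ, ℂ)) F y u)
        (mfderiv I₁ (I.prod 𝓘(ℝ, ℂ)) F y v) = 0) (y₀ : N) :
    ∃ (U : Set N) (s : N → ℝ), (IsOpen U ∧ ∀ y ∈ U,
      HasMFDerivAt I₁ 𝓘(ℝ, ℝ) s y (α.prodPullback I₁ F y)) ∧ y₀ ∈ U := by
  let ψ := extChartAt I₁ y₀
  obtain ⟨ε, hε, hball⟩ := Metric.mem_nhds_iff.1 (extChartAt_target_mem_nhds (I := I₁) y₀)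
  set B := Metric.ball (extChartAt I₁ y₀ y₀) ε
  have hBo : IsOpen B := Metric.isOpen_ball
  have hBu : UniqueDiffOn ℝ B := hBo.uniqueDiffOn
  have hF1 : ContMDiff I₁ I ∞ (fun y ↦ (F y).1) := contMDiff_fst.comp hF
  have hF2 : ContMDiff I₁ 𝓘(ℝ, ℂ) ∞ (fun y ↦ (F y).2) := contMDiff_snd.comp hF
  have hψ : ContMDiffOn 𝓘(ℝ, E₁) I₁ ∞ ψ.symm B := (contMDiffOn_extChartAt_symm y₀).mono hball
  let u₁ : E₁ → M := fun z ↦ (F (ψ.symm z)).1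
  let u₂ : E₁ → ℂ := fun z ↦ (F (ψ.symm z)).2
  have hu₁ : ContMDiffOn 𝓘(ℝ, E₁) I 2 u₁ B :=
    (hF1.comp_contMDiffOn hψ).of_le two_le_infty
  have hu₂ : ContDiffOn ℝ 2 u₂ B :=
    ((hF2.comp_contMDiffOn hψ).of_le two_le_infty).contDiffOn
  have hψd : ∀ z ∈ B, HasMFDerivAt 𝓘(ℝ, E₁) I₁ ψ.symm z (mfderiv 𝓘(ℝ, E₁) I₁ ψ.symm z) :=
    fun z hz ↦ ((hψ.contMDiffAt (hBo.mem_nhds hz)).mdifferentiableAt (by simp)).hasMFDerivAt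
  have hF1d : ∀ y, HasMFDerivAt I₁ I (fun y ↦ (F y).1) y (mfderiv I₁ I (fun y ↦ (F y).1) y) :=
    fun y ↦ (hF1.contMDiffAt.mdifferentiableAt (by simp)).hasMFDerivAt
  have hF2d : ∀ y, HasMFDerivAt I₁ 𝓘(ℝ, ℂ) (fun y ↦ (F y).2) y
      (mfderiv I₁ 𝓘(ℝ, ℂ) (fun y ↦ (F y).2) y) :=
    fun y ↦ (hF2.contMDiffAt.mdifferentiableAt (by simp)).hasMFDerivAt
  have hd₁ : ∀ z ∈ B, mfderivWithin 𝓘(ℝ, E₁) I u₁ B z =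
      (mfderiv I₁ I (fun y ↦ (F y).1) (ψ.symm z)).comp (mfderiv 𝓘(ℝ, E₁) I₁ ψ.symm z) :=
    fun z hz ↦ ((hF1d _).comp z (hψd z hz)).hasMFDerivWithinAt.mfderivWithin
      (hBu z hz).uniqueMDiffWithinAt
  have hd₂ : ∀ z ∈ B, fderivWithin ℝ u₂ B z =
      (mfderiv I₁ 𝓘(ℝ, ℂ) (fun y ↦ (F y).2) (ψ.symm z)).comp (mfderiv 𝓘(ℝ, E₁) I₁ ψ.symm z) :=
    fun z hz ↦ mfderivWithin_eq_fderivWithin.symm.trans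
      (((hF2d _).comp z (hψd z hz)).hasMFDerivWithinAt.mfderivWithin
        (hBu z hz).uniqueMDiffWithinAt)
  have hc₁ := α.contDiffOn_pullback hBu hu₁
  have hc₂ := contDiffOn_liouvillePullback hBu hu₂
  let β : E₁ → E₁ →L[ℝ] ℝ := fun z ↦ α.pullback u₁ B z + liouvillePullback u₂ B z
  have hβ : DifferentiableOn ℝ β B := (hc₁.add hc₂).differentiableOn (by norm_num)
  -- Poincaré's lemma on a chart ball: the antisymmetric part of the derivative of `β` is the
  -- pull-back of `dα ⊕ dx ∧ dy`, which vanishes by `hω`.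
  obtain ⟨S, hS⟩ := (convex_ball _ _).exists_forall_hasFDerivAt_of_fderiv_symmetric hBo
    hβ (by
      intro z hz a b
      have hz' : z ∈ closure (interior B) := by
        rw [hBo.interior_eq]; exact subset_closure hz
      have e₁ := α.fderivWithin_pullback_sub hBu hu₁ hz hz' a b
      have e₂ := fderivWithin_liouvillePullback_sub hBu hu₂ hz hz' a b
      have e₃ := hω (ψ.symm z) (mfderiv 𝓘(ℝ, E₁) I₁ ψ.symm z a) (mfderiv 𝓘(ℝ, E₁) I₁ ψ.symm z b)
      have e₄ : mfderiv I₁ (I.prod 𝓘(ℝ, ℂ)) F (ψ.symm z) =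
          (mfderiv I₁ I (fun y ↦ (F y).1) (ψ.symm z)).prod
            (mfderiv I₁ 𝓘(ℝ, ℂ) (fun y ↦ (F y).2) (ψ.symm z)) :=
        ((hF1d _).prodMk (hF2d _)).mfderiv
      rw [e₄] at e₃
      rw [hd₁ z hz] at e₁
      rw [hd₂ z hz] at e₂
      have e₅ := hBo.mem_nhds hz
      rw [← fderivWithin_of_mem_nhds e₅, fderivWithin_fun_add (hBu z hz)
        (hc₁.differentiableOn (by norm_num) z hz) (hc₂.differentiableOn (by norm_num) z hz)]
      have e₆ : α.d (u₁ z)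
          ((mfderiv I₁ I (fun y ↦ (F y).1) (ψ.symm z)).comp (mfderiv 𝓘(ℝ, E₁) I₁ ψ.symm z) a)
          ((mfderiv I₁ I (fun y ↦ (F y).1) (ψ.symm z)).comp (mfderiv 𝓘(ℝ, E₁) I₁ ψ.symm z) b) +
          stdSymplectic
          ((mfderiv I₁ 𝓘(ℝ, ℂ) (fun y ↦ (F y).2) (ψ.symm z)).comp (mfderiv 𝓘(ℝ, E₁) I₁ ψ.symm z) a)
          ((mfderiv I₁ 𝓘(ℝ, ℂ) (fun y ↦ (F y).2) (ψ.symm z)).comp (mfderiv 𝓘(ℝ, E₁) I₁ ψ.symm z) b)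
            = 0 := e₃
      have e₇ := (congrArg₂ (· + ·) e₁ e₂).trans e₆
      simp only [add_apply]
      linarith)
  refine ⟨ψ.source ∩ ψ ⁻¹' B, fun y ↦ S (ψ y), ⟨isOpen_extChartAt_preimage' y₀ hBo, ?_⟩,
    mem_extChartAt_source y₀, Metric.mem_ball_self hε⟩
  rintro y ⟨hys, hyB⟩
  have hys' : y ∈ (chartAt H₁ y₀).source := by simpa [ψ] using hys
  have h1 : HasMFDerivAt I₁ 𝓘(ℝ, E₁) ψ y (mfderiv I₁ 𝓘(ℝ, E₁) ψ y) :=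
    (mdifferentiableAt_extChartAt hys').hasMFDerivAt
  have h2 := (hS (ψ y) hyB).hasMFDerivAt.comp y h1
  have h3 : (mfderiv 𝓘(ℝ, E₁) I₁ ψ.symm (ψ y)).comp (mfderiv I₁ 𝓘(ℝ, E₁) ψ y) =
      ContinuousLinearMap.id ℝ (TangentSpace I₁ y) := by
    have := mfderivWithin_extChartAt_symm_comp_mfderiv_extChartAt' (I := I₁) hys
    rwa [I₁.range_eq_univ, mfderivWithin_univ] at this
  -- Taking vectors in the model space `E₁` removes the dependence of their type on the base point,
  -- so point and vector can be replaced together.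
  let k : N → E₁ → ℝ := fun y b ↦ α.prodPullback I₁ F y b
  have h4 : α.prodPullback I₁ F y = (β (ψ y)).comp (mfderiv I₁ 𝓘(ℝ, E₁) ψ y) := by
    ext b
    have h5 : k (ψ.symm (ψ y)) (mfderiv 𝓘(ℝ, E₁) I₁ ψ.symm (ψ y) (mfderiv I₁ 𝓘(ℝ, E₁) ψ y b)) =
        k y b := congrArg₂ k (ψ.left_inv hys) (DFunLike.congr_fun h3 b)
    refine h5.symm.trans ?_
    simp only [β, SmoothOneForm.pullback, liouvillePullback]
    rw [hd₁ _ hyB, hd₂ _ hyB]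
    rfl
  rw [h4]
  exact h2

end Lagrangian

/-! ### Immersions and derivatives along the circle -/

section Boundary

variable {E : Type*} [NormedAddCommGroup E] [NormedSpace ℝ E]
    {H : Type*} [TopologicalSpace H] {I : ModelWithCorners ℝ E H}
    {M : Type*} [TopologicalSpace M] [ChartedSpace H M]
    {E₁ : Type*} [NormedAddCommGroup E₁] [NormedSpace ℝ E₁]
    {H₁ : Type*} [TopologicalSpace H₁] {I₁ : ModelWithCorners ℝ E₁ H₁}
    {N : Type*} [TopologicalSpace N] [ChartedSpace H₁ N]

theorem Manifold.IsImmersionAt.of_le {m n : ℕ∞ω} (hmn : m ≤ n) {F : N → M} {y : N}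
    (h : IsImmersionAt I₁ I n F y) : IsImmersionAt I₁ I m F y :=
  IsImmersionAt.mk_of_charts h.equiv h.domChart h.codChart h.mem_domChart_source
    h.mem_codChart_source (IsManifold.maximalAtlas_subset_of_le hmn h.domChart_mem_maximalAtlas)
    (IsManifold.maximalAtlas_subset_of_le hmn h.codChart_mem_maximalAtlas)
    h.source_subset_preimage_source h.writtenInCharts

open Complex

theorem exp_mul_I_mem_sphere (θ : ℝ) : exp (θ * Complex.I) ∈ Metric.sphere (0 : ℂ) 1 := by
  simp [Complex.norm_exp_ofReal_mul_I]

theorem exp_mul_I_mem_unitDisc (θ : ℝ) : exp (θ * Complex.I) ∈ unitDisc :=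
  Metric.sphere_subset_closedBall (exp_mul_I_mem_sphere θ)

theorem hasDerivAt_exp_mul_I (θ : ℝ) :
    HasDerivAt (fun t : ℝ ↦ exp (t * Complex.I)) (Complex.I * exp (θ * Complex.I)) θ := by
  have := ((Complex.ofRealCLM.hasDerivAt (x := θ)).mul_const I).cexp
  simpa [mul_comm] using this

theorem contDiff_exp_mul_I {n : ℕ∞ω} : ContDiff ℝ n (fun t : ℝ ↦ exp (t * Complex.I)) :=
  (Complex.ofRealCLM.contDiff.mul contDiff_const).cexp

theorem hasMFDerivAt_comp_exp_mul_I {u : ℂ → M}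
    (hu : MDifferentiableOn 𝓘(ℝ, ℂ) I u unitDisc) (θ : ℝ) :
    mfderiv 𝓘(ℝ, ℝ) I (fun t : ℝ ↦ u (exp (t * Complex.I))) θ (1 : ℝ) =
      mfderivWithin 𝓘(ℝ, ℂ) I u unitDisc (exp (θ * Complex.I)) (Complex.I * exp (θ * Complex.I)) := by
  have h1 := (hasDerivAt_exp_mul_I θ).hasFDerivAt.hasMFDerivAt.hasMFDerivWithinAt (s := univ)
  have h2 := ((hu _ (exp_mul_I_mem_unitDisc θ)).hasMFDerivWithinAt.comp θ h1
    (by exact fun t _ ↦ exp_mul_I_mem_unitDisc t))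
  rw [hasMFDerivWithinAt_univ] at h2
  have h3 := DFunLike.congr_fun h2.mfderiv (1 : ℝ)
  exact h3.trans (congrArg (mfderivWithin 𝓘(ℝ, ℂ) I u unitDisc (exp (θ * Complex.I)))
    (one_smul ℝ (Complex.I * exp (θ * Complex.I))))

end Boundary

/-! ### Vanishing of the boundary integral -/

section Boundary

variable {E : Type*} [NormedAddCommGroup E] [NormedSpace ℝ E]
    {H : Type*} [TopologicalSpace H] {I : ModelWithCorners ℝ E H} [I.Boundaryless]
    {M : Type*} [TopologicalSpace M] [ChartedSpace H M] [IsManifold I ∞ M]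
    {E₁ : Type*} [NormedAddCommGroup E₁] [NormedSpace ℝ E₁]
    {H₁ : Type*} [TopologicalSpace H₁] {I₁ : ModelWithCorners ℝ E₁ H₁} [I₁.Boundaryless]
    {N : Type*} [TopologicalSpace N] [ChartedSpace H₁ N] [IsManifold I₁ ∞ N]

open Complex in
/-- The integral of `α ⊕ x dy` over the boundary of a disc that is null-homotopic relative to a
Lagrangian submanifold vanishes. -/
theorem integral_boundary_eq_zero (α : SmoothOneForm I (M := M)) {F : N → M × ℂ}
    (hF : IsLagrangianEmbedding I₁ α F) {v' : ℂ → M} {f : ℂ → ℂ}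
    (hv' : ContMDiffOn 𝓘(ℝ, ℂ) I 2 v' unitDisc) (hf : ContDiffOn ℝ 2 f unitDisc)
    (hb : ∀ z ∈ Metric.sphere (0 : ℂ) 1, (v' z, f z) ∈ range F)
    (hhom : HomotopicToConstRel (fun z ↦ (v' z, f z)) (range F)) :
    ∫ θ in -Real.pi..Real.pi,
      (α.pullback v' unitDisc (exp (θ * Complex.I)) + liouvillePullback f unitDisc (exp (θ * Complex.I)))
        (Complex.I * exp (θ * Complex.I)) = 0 := by
  have hFe : IsEmbedding F := hF.isSmoothEmbedding.isEmbedding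
  have hFs := hF.isSmoothEmbedding.contMDiff
  let e := hFe.toHomeomorph
  have he : ∀ x : range F, F (e.symm x) = x := fun x ↦ congrArg Subtype.val (e.apply_symm_apply x)
  obtain ⟨p, hp, h, hc, h0, h1, hW⟩ := hhom
  -- The boundary loop lifted to `N`. It is continuous because `F` is a topological embedding, and
  -- `C²` because `F` is an immersion and `F ∘ η` is `C²`.
  let η : ℝ → N := fun θ ↦ e.symm ⟨_, hb _ (exp_mul_I_mem_sphere θ)⟩
  have hFη : ∀ θ, F (η θ) = (v' (exp (θ * Complex.I)), f (exp (θ * Complex.I))) := fun θ ↦ he _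
  have hv1 : ContMDiff 𝓘(ℝ, ℝ) I 2 (fun θ : ℝ ↦ v' (exp (θ * Complex.I))) := by
    rw [← contMDiffOn_univ]
    exact hv'.comp contDiff_exp_mul_I.contMDiff.contMDiffOn fun t _ ↦ exp_mul_I_mem_unitDisc t
  have hf1 : ContMDiff 𝓘(ℝ, ℝ) 𝓘(ℝ, ℂ) 2 (fun θ : ℝ ↦ f (exp (θ * Complex.I))) := by
    rw [← contMDiffOn_univ]
    exact hf.contMDiffOn.comp contDiff_exp_mul_I.contMDiff.contMDiffOn
      fun t _ ↦ exp_mul_I_mem_unitDisc t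
  have hγ : ContMDiff 𝓘(ℝ, ℝ) (I.prod 𝓘(ℝ, ℂ)) 2 (fun θ ↦ F (η θ)) := by
    simp_rw [hFη]; exact hv1.prodMk hf1
  have hηc : Continuous η := hFe.continuous_iff.2 hγ.continuous
  have hη : ContMDiff 𝓘(ℝ, ℝ) I₁ 2 η := fun θ ↦
    (ContMDiffAt.iff_comp_isImmersionAt
      ((hF.isSmoothEmbedding.isImmersion.isImmersionAt (η θ)).of_le two_le_infty)).2
      ⟨hηc.continuousAt, hγ θ⟩
  let b : ℝ → ℝ := fun θ ↦
    (α.pullback v' unitDisc (exp (θ * Complex.I)) + liouvillePullback f unitDisc (exp (θ * Complex.I)))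
      (Complex.I * exp (θ * Complex.I))
  have hbc : Continuous b := by
    have hm : ∀ t : ℝ, exp (t * Complex.I) ∈ unitDisc := exp_mul_I_mem_unitDisc
    have c1 := (α.contDiffOn_pullback uniqueDiffOn_unitDisc hv').continuousOn
    have c2 := (contDiffOn_liouvillePullback uniqueDiffOn_unitDisc hf).continuousOn
    have c3 : Continuous fun t : ℝ ↦ exp (t * Complex.I) := by fun_prop
    exact ((c1.comp_continuous c3 hm).add (c2.comp_continuous c3 hm)).clm_apply (by fun_prop)
  have hF1 : ∀ y, MDifferentiableAt I₁ I (fun y ↦ (F y).1) y := fun y ↦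
    (contMDiff_fst.comp hFs).contMDiffAt.mdifferentiableAt (by simp)
  have hF2 : ∀ y, MDifferentiableAt I₁ 𝓘(ℝ, ℂ) (fun y ↦ (F y).2) y := fun y ↦
    (contMDiff_snd.comp hFs).contMDiffAt.mdifferentiableAt (by simp)
  have hprim : ∀ θ, α.prodPullback I₁ F (η θ) (mfderiv 𝓘(ℝ, ℝ) I₁ η θ (1 : ℝ)) = b θ := by
    intro θ
    have hηd : HasMFDerivAt 𝓘(ℝ, ℝ) I₁ η θ (mfderiv 𝓘(ℝ, ℝ) I₁ η θ) :=
      (hη.contMDiffAt.mdifferentiableAt (by norm_num)).hasMFDerivAt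
    have d1 := ((hF1 (η θ)).hasMFDerivAt.comp θ hηd).mfderiv
    have d2 := ((hF2 (η θ)).hasMFDerivAt.comp θ hηd).mfderiv
    have f1 : (fun y ↦ (F y).1) ∘ η = fun t : ℝ ↦ v' (exp (t * Complex.I)) := by
      ext t; simp [hFη]
    have f2 : (fun y ↦ (F y).2) ∘ η = fun t : ℝ ↦ f (exp (t * Complex.I)) := by
      ext t; simp [hFη]
    -- Evaluations as functions of the whole curve, so that equal curves can be exchanged despite
    -- the dependent tangent spaces.
    let Φ : (ℝ → M) → ℝ := fun k ↦ α.toFun (k θ) (mfderiv 𝓘(ℝ, ℝ) I k θ (1 : ℝ))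
    let Ψ : (ℝ → ℂ) → ℝ := fun k ↦ liouvilleForm (k θ) (mfderiv 𝓘(ℝ, ℝ) 𝓘(ℝ, ℂ) k θ (1 : ℝ))
    have g1 : α.toFun (F (η θ)).1 (mfderiv I₁ I (fun y ↦ (F y).1) (η θ)
        (mfderiv 𝓘(ℝ, ℝ) I₁ η θ (1 : ℝ))) = α.pullback v' unitDisc (exp (θ * Complex.I))
          (Complex.I * exp (θ * Complex.I)) := by
      refine (congrArg (α.toFun (F (η θ)).1) (DFunLike.congr_fun d1 (1 : ℝ)).symm).trans ?_
      refine (congrArg Φ f1).trans ?_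
      exact congrArg (α.toFun (v' (exp (θ * Complex.I))))
        (hasMFDerivAt_comp_exp_mul_I (hv'.mdifferentiableOn (by norm_num)) θ)
    have g2 : liouvilleForm (F (η θ)).2 (mfderiv I₁ 𝓘(ℝ, ℂ) (fun y ↦ (F y).2) (η θ)
        (mfderiv 𝓘(ℝ, ℝ) I₁ η θ (1 : ℝ))) = liouvillePullback f unitDisc (exp (θ * Complex.I))
          (Complex.I * exp (θ * Complex.I)) := by
      refine (congrArg (liouvilleForm (F (η θ)).2) (DFunLike.congr_fun d2 (1 : ℝ)).symm).trans ?_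
      refine (congrArg Ψ f2).trans ?_
      refine (congrArg (liouvilleForm (f (exp (θ * Complex.I))))
        (hasMFDerivAt_comp_exp_mul_I (hf.contMDiffOn.mdifferentiableOn (by norm_num)) θ)).trans ?_
      rw [mfderivWithin_eq_fderivWithin]
      rfl
    exact congrArg₂ (· + ·) g1 g2
  -- The affine map of `[0, 1]` onto `[-π, π]`. Through it the homotopy, restricted to the boundary
  -- circle, becomes the map `K` of the square into `N`.
  let ang : ℝ → ℝ := fun τ ↦ 2 * Real.pi * τ - Real.pi
  let K : unitInterval × unitInterval → N := fun q ↦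
    e.symm ⟨h (q.1, exp (ang q.2 * Complex.I)), hW q.1 q.1.2 _ (exp_mul_I_mem_sphere _)⟩
  have hK0 : ∀ τ : unitInterval, K (0, τ) = η (ang τ) := fun τ ↦ hFe.injective <| by
    rw [hFη]
    exact (he _).trans (h0 _ (exp_mul_I_mem_unitDisc _))
  have key := eq_of_nullhomotopic_of_localPrimitives
    (fun U s ↦ IsOpen U ∧ ∀ y ∈ U, HasMFDerivAt I₁ 𝓘(ℝ, ℝ) s y (α.prodPullback I₁ F y))
    (fun _ _ h ↦ h.1) (α.exists_localPrimitive hFs hF.pullback_eq_zero)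
    (fun U s U' s' hs hs' ↦ eventually_sub_eq_of_hasMFDerivAt hs.1 hs'.1 hs.2 hs'.2)
    K
    (e.symm.continuous.comp <| Continuous.subtype_mk (hc.comp_continuous (by fun_prop)
      fun q ↦ ⟨q.1.2, exp_mul_I_mem_unitDisc _⟩) _)
    (fun t ↦ by
      have h2 : exp (ang 0 * Complex.I) = exp (ang 1 * Complex.I) := by
        have e1 : ang 0 = -Real.pi := by simp [ang]
        have e2 : ang 1 = Real.pi := by simp only [ang]; ring
        rw [e1, e2]
        simp [Complex.exp_neg]
      refine hFe.injective ((he _).trans (Eq.trans ?_ (he _).symm))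
      simp only [Set.Icc.coe_zero, Set.Icc.coe_one, h2])
    (e.symm ⟨p, hp⟩)
    (fun θ ↦ hFe.injective <| (he _).trans
      ((h1 _ (exp_mul_I_mem_unitDisc _)).trans (he ⟨p, hp⟩).symm))
    -- The increments of this `L` agree with those of a local primitive `s` by the fundamental
    -- theorem of calculus, since `s ∘ η` has derivative `b` by `hprim`.
    (fun τ ↦ ∫ θ in -Real.pi..ang τ, b θ)
    (fun U s hs a c hac hU ↦ by
      have hac' : ang a ≤ ang c := by
        have : (a : ℝ) ≤ c := hac
        simp only [ang]
        nlinarith [Real.pi_pos]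
      rw [intervalIntegral.integral_interval_sub_left (hbc.intervalIntegrable _ _)
        (hbc.intervalIntegrable _ _), hK0, hK0]
      refine (intervalIntegral.integral_eq_sub_of_hasDerivAt (f := fun t ↦ s (η t)) ?_
        (hbc.intervalIntegrable _ _)).symm
      intro θ hθ
      rw [uIcc_of_le hac'] at hθ
      have hθU : η θ ∈ U := by
        have e1 : ang ((θ + Real.pi) / (2 * Real.pi)) = θ := by
          simp only [ang]; field_simp; ring
        have e2 : (a : ℝ) ≤ (θ + Real.pi) / (2 * Real.pi) := by
          rw [le_div_iff₀ (by positivity)]; have := hθ.1; simp only [ang] at this; linarith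
        have e3 : (θ + Real.pi) / (2 * Real.pi) ≤ c := by
          rw [div_le_iff₀ (by positivity)]; have := hθ.2; simp only [ang] at this; linarith
        have e4 := hU ⟨(θ + Real.pi) / (2 * Real.pi), a.2.1.trans e2, e3.trans c.2.2⟩ ⟨e2, e3⟩
        rw [hK0] at e4
        simpa only [e1] using e4
      have hηd : HasMFDerivAt 𝓘(ℝ, ℝ) I₁ η θ (mfderiv 𝓘(ℝ, ℝ) I₁ η θ) :=
        (hη.contMDiffAt.mdifferentiableAt (by norm_num)).hasMFDerivAt
      let ds : ℝ →L[ℝ] ℝ := (α.prodPullback I₁ F (η θ)).comp (mfderiv 𝓘(ℝ, ℝ) I₁ η θ)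
      have h2 : HasFDerivAt (fun t ↦ s (η t)) ds θ :=
        ((hs.2 _ hθU).comp θ hηd).hasFDerivAt
      rw [← hprim θ]
      exact h2.hasDerivAt)
  have e1 : ang 0 = -Real.pi := by simp [ang]
  have e2 : ang 1 = Real.pi := by simp only [ang]; ring
  simp only [Set.Icc.coe_zero, Set.Icc.coe_one, e1, e2,
    intervalIntegral.integral_same] at key
  exact key.symm

end Boundary

/-! ### Pointwise energy identities and the bound on `c` -/

section Energy

open Complex

variable {E : Type*} [NormedAddCommGroup E] [NormedSpace ℝ E]
    {H : Type*} [TopologicalSpace H] {I : ModelWithCorners ℝ E H}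
    {M : Type*} [TopologicalSpace M] [ChartedSpace H M] [IsManifold I ∞ M]

theorem SmoothOneForm.d_swap (α : SmoothOneForm I (M := M)) (x : M) (u v : TangentSpace I x) :
    α.d x u v = -α.d x v u := by
  simp [SmoothOneForm.d]

theorem SmoothOneForm.d_neg_right (α : SmoothOneForm I (M := M)) (x : M)
    (u v : TangentSpace I x) : α.d x u (-v) = -α.d x u v := by
  have key (A : E →L[ℝ] E →L[ℝ] ℝ) (a b : E) : A a (-b) - A (-b) a = -(A a b - A b a) := by
    simp only [map_neg, neg_apply]
    ring
  simp only [SmoothOneForm.d, map_neg]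
  exact key _ _ _

/-- The equation gives `J v = -u` and hence `J u = v`, so each of the two squares is `dα (u, v)`. -/
theorem IsAdaptedMetric.inner_add_inner_eq
    {g : ContMDiffRiemannianMetric I ∞ E (fun x : M ↦ TangentSpace I x)}
    {α : SmoothOneForm I (M := M)} {J : AlmostComplexStructure I (M := M)}
    (hg : IsAdaptedMetric g α J) (x : M) {u v : TangentSpace I x} (h : u + J.toFun x v = 0) :
    g.inner x u u + g.inner x v v = 2 * α.d x u v := by
  have h1 : J.toFun x v = -u := by rw [eq_neg_iff_add_eq_zero, add_comm]; exact h
  have h2 : J.toFun x u = v := by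
    have := J.sq x v
    rwa [h1, map_neg, neg_inj] at this
  rw [hg, hg, h1, h2, α.d_neg_right, α.d_swap x v u]
  ring

theorem norm_sq_add_norm_sq_eq (p q : ℂ) :
    ‖p‖ ^ 2 + ‖q‖ ^ 2 = 2 * stdSymplectic p q + ‖p + Complex.I * q‖ ^ 2 := by
  simp only [← Complex.normSq_eq_norm_sq, Complex.normSq_apply, stdSymplectic]
  simp
  ring

/-- The form `-i f dz` has curl `∂f/∂x + i ∂f/∂y = c`, so Stokes gives `π ‖c‖ ≤ 2π R`. -/
theorem norm_le_of_cauchyRiemann {f : ℂ → ℂ} (hf : ContDiffOn ℝ 1 f unitDisc) {c : ℂ}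
    (hc : ∀ z ∈ unitDisc,
      fderivWithin ℝ f unitDisc z 1 + Complex.I * fderivWithin ℝ f unitDisc z Complex.I = c)
    {R : ℝ} (hR : ∀ z ∈ Metric.sphere (0 : ℂ) 1, ‖f z‖ ≤ R) : ‖c‖ ≤ 2 * R := by
  -- `Λ (f z)` is the form `-i f dz`; the factor `-i` makes its curl exactly `c`.
  let Λ : ℂ →L[ℝ] ℂ →L[ℝ] ℂ := (-Complex.I) • ContinuousLinearMap.mul ℝ ℂ
  have hΛ : ContDiffOn ℝ 1 (fun z ↦ Λ (f z)) unitDisc := Λ.contDiff.comp_contDiffOn hf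
  have h1 := integral_unitDisc_curl _ hΛ
  have h2 : ∀ z ∈ unitDisc, fderivWithin ℝ (fun z ↦ Λ (f z)) unitDisc z 1 Complex.I -
      fderivWithin ℝ (fun z ↦ Λ (f z)) unitDisc z Complex.I 1 = c := by
    intro z hz
    have h3 := (Λ.hasFDerivAt.comp_hasFDerivWithinAt z
      (hf.differentiableOn (by norm_num) z hz).hasFDerivWithinAt).fderivWithin
      (uniqueDiffOn_unitDisc z hz)
    have h4 : fderivWithin ℝ (fun z ↦ Λ (f z)) unitDisc z = _ := h3
    rw [h4, ← hc z hz]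
    simp only [Λ, ContinuousLinearMap.comp_apply, smul_apply, ContinuousLinearMap.mul_apply',
      smul_eq_mul]
    linear_combination (-fderivWithin ℝ f unitDisc z 1) * I_sq
  rw [MeasureTheory.setIntegral_congr_fun measurableSet_unitDisc h2,
    MeasureTheory.setIntegral_const] at h1
  have h5 : MeasureTheory.volume.real unitDisc = Real.pi := by
    simp [MeasureTheory.Measure.real, unitDisc]
  rw [h5] at h1
  have h6 : ‖∫ θ in -Real.pi..Real.pi, Λ (f (exp (θ * Complex.I))) (Complex.I * exp (θ * Complex.I))‖ ≤
      R * |Real.pi - -Real.pi| := by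
    refine intervalIntegral.norm_integral_le_of_norm_le_const fun θ _ ↦ ?_
    simpa [Λ, Complex.norm_exp_ofReal_mul_I] using hR _ (exp_mul_I_mem_sphere θ)
  rw [← h1, norm_smul, Real.norm_of_nonneg Real.pi_pos.le,
    abs_of_pos (by linarith [Real.pi_pos])] at h6
  nlinarith [Real.pi_pos]

end Energy

/-! ### The energy estimate -/

theorem lemma4p1
    {E : Type*} [NormedAddCommGroup E] [NormedSpace ℝ E] [FiniteDimensional ℝ E]
    {H : Type*} [TopologicalSpace H] (I : ModelWithCorners ℝ E H) [I.Boundaryless]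
    {M : Type*} [TopologicalSpace M] [ChartedSpace H M] [IsManifold I ∞ M]
    {E₁ : Type*} [NormedAddCommGroup E₁] [NormedSpace ℝ E₁] [FiniteDimensional ℝ E₁]
    {H₁ : Type*} [TopologicalSpace H₁] (I₁ : ModelWithCorners ℝ E₁ H₁) [I₁.Boundaryless]
    {N : Type*} [TopologicalSpace N] [ChartedSpace H₁ N] [IsManifold I₁ ∞ N]
    (α : SmoothOneForm I (M := M)) (hα : α.IsSymplecticPrimitive)
    (J : AlmostComplexStructure I (M := M))
    (g : ContMDiffRiemannianMetric I ∞ E (fun x : M ↦ TangentSpace I x))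
    (hg : IsAdaptedMetric g α J)
    (F : N → M × ℂ) (hF : IsLagrangianEmbedding I₁ α F)
    (R : ℝ) (hR : ∀ p ∈ Set.range F, ‖p.2‖ ≤ R)
    (c : ℂ) (hc : c ≠ 0)
    (v' : ℂ → M) (f : ℂ → ℂ)
    (hv : SolvesPerturbedCR J (Set.range F) c v' f)
    (hhom : HomotopicToConstRel (fun z ↦ (v' z, f z)) (Set.range F)) :
    MeasureTheory.IntegrableOn (energyDensity g v' f) unitDisc MeasureTheory.volume ∧
      ∫ z in unitDisc, energyDensity g v' f z ≤ 4 * Real.pi * R ^ 2 := by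
  have hv' := hv.contMDiffOn_fst
  have hf := hv.contDiffOn_snd
  let β : ℂ → ℂ →L[ℝ] ℝ := fun z ↦ α.pullback v' unitDisc z + liouvillePullback f unitDisc z
  have hβ₁ := α.contDiffOn_pullback uniqueDiffOn_unitDisc hv'
  have hβ₂ := contDiffOn_liouvillePullback uniqueDiffOn_unitDisc hf
  have hβ : ContDiffOn ℝ 1 β unitDisc := hβ₁.add hβ₂
  -- The density is twice the pulled-back symplectic form, written as the curl of `β`, plus the
  -- constant `‖c‖ ^ 2`. Its continuity also yields integrability.
  have henergy : ∀ z ∈ unitDisc, energyDensity g v' f z =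
      2 * (fderivWithin ℝ β unitDisc z 1 Complex.I - fderivWithin ℝ β unitDisc z Complex.I 1) +
        ‖c‖ ^ 2 := by
    intro z hz
    have e₁ := α.fderivWithin_pullback_sub uniqueDiffOn_unitDisc hv' hz
      (mem_closure_interior_unitDisc hz) 1 Complex.I
    have e₂ := fderivWithin_liouvillePullback_sub uniqueDiffOn_unitDisc hf hz
      (mem_closure_interior_unitDisc hz) 1 Complex.I
    have e₃ : fderivWithin ℝ β unitDisc z = _ := fderivWithin_fun_add (uniqueDiffOn_unitDisc z hz)
      (hβ₁.differentiableOn (by norm_num) z hz) (hβ₂.differentiableOn (by norm_num) z hz)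
    have e₄ := hg.inner_add_inner_eq (v' z) (hv.eq_fst z hz)
    have e₅ := norm_sq_add_norm_sq_eq (fderivWithin ℝ f unitDisc z 1)
      (fderivWithin ℝ f unitDisc z Complex.I)
    rw [hv.eq_snd z hz] at e₅
    have e₆ : α.d (v' z) (partialX I v' z) (partialY I v' z) = _ := e₁.symm
    rw [e₆] at e₄
    simp only [energyDensity, e₃, add_apply]
    linarith
  have hcurl : ContinuousOn (fun z ↦ fderivWithin ℝ β unitDisc z 1 Complex.I -
      fderivWithin ℝ β unitDisc z Complex.I 1) unitDisc := by
    have := hβ.continuousOn_fderivWithin uniqueDiffOn_unitDisc le_rfl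
    fun_prop
  have hint := hcurl.integrableOn_compact (μ := MeasureTheory.volume) isCompact_unitDisc
  have hconst : MeasureTheory.IntegrableOn (fun _ : ℂ ↦ ‖c‖ ^ 2) unitDisc :=
    continuousOn_const.integrableOn_compact isCompact_unitDisc
  constructor
  · exact MeasureTheory.IntegrableOn.congr_fun ((hint.const_mul 2).add hconst)
      (fun z hz ↦ (henergy z hz).symm) measurableSet_unitDisc
  rw [MeasureTheory.setIntegral_congr_fun measurableSet_unitDisc henergy,
    MeasureTheory.integral_add (hint.const_mul 2) hconst, MeasureTheory.integral_const_mul,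
    integral_unitDisc_curl β hβ, MeasureTheory.setIntegral_const]
  have hzero : ∫ θ in -Real.pi..Real.pi, β (Complex.exp (θ * Complex.I))
      (Complex.I * Complex.exp (θ * Complex.I)) = 0 :=
    integral_boundary_eq_zero α hF hv' hf hv.boundary hhom
  have hvol : MeasureTheory.volume.real unitDisc = Real.pi := by
    simp [MeasureTheory.Measure.real, unitDisc]
  have hcR : ‖c‖ ≤ 2 * R := norm_le_of_cauchyRiemann (hf.of_le (by norm_num)) hv.eq_snd
    fun z hz ↦ hR _ (hv.boundary z hz)
  have hsq : ‖c‖ ^ 2 ≤ (2 * R) ^ 2 := pow_le_pow_left₀ (norm_nonneg c) hcR 2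
  -- The energy is now `2 * 0 + π * ‖c‖ ^ 2`.
  rw [hzero, hvol, smul_eq_mul]
  nlinarith [Real.pi_pos]
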